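/- Let $n$ and $k$ be nonnegative integers and let $\mathbf{k}$ be a commutative ring in which $n!$ is invertible. Let $\mathcal{A}=\mathbf{k}[S_n]$ be the group algebra of the symmetric group $S_n$ on $[n]=\{1,\dots,n\}$, and let $T_{\operatorname{sign}}:\mathcal{A}\to\mathcal{A}$ be the $\mathbf{k}$-linear map that sends each $w\in S_n$ to $(-1)^w w$. For $U\subseteq[n]$ let $\nabla_U^-=\sum (-1)^w w$, the sum ranging over all $w\in S_n$ with $w(i)=i$ for all $i\in[n]\setminus U$. For an integer $m\ge 0$ let $\mathcal{J}_m=\mathcal{A}\cdot\operatorname{span}\{\nabla_U^- \mid U\subseteq[n],\ |U|=m+1\}\cdot\mathcal{A}$; for $m<0$ let $\mathcal{J}_m=\mathcal{A}$. For $k$-tuples $\mathbf{a},\mathbf{b}\in[n]^k$ let $\nabla_{\mathbf{b},\mathbf{a}}=\sum w$, the sum ranging over all $w\in S_n$ with $w(a_i)=b_i$ for all $i$. For each partition $\lambda$ of $n$ let $S^\lambda=\mathcal{A}\,\mathbf{a}_\lambda\mathbf{b}_\lambda$ be its Specht module, where $\mathbf{a}_\lambda$ is the sum of all permutations preserving the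 rows of $T_\lambda$ as sets, $\mathbf{b}_\lambda$ is the signed sum of all permutations preserving the columns of $T_\lambda$ as sets, and $T_\lambda$ is the Young tableau of shape $\lambda$ filled with $1,\dots,n$ row by row, from the top row down. Let $\operatorname{AW}:\mathcal{A}\to\prod_{\lambda\vdash n}\operatorname{End}_{\mathbf{k}}(S^\lambda)$ be the $\mathbf{k}$-algebra homomorphism that sends $a$ to the family of its actions on the $S^\lambda$ (the Artin--Wedderburn map). For a set $U$ of partitions of $n$ let $\mathcal{A}_U$ be the preimage under $\operatorname{AW}$ of the subproduct $\prod_{\lambda\in U}\operatorname{End}_{\mathbf{k}}(S^\lambda)$, i.e. of the set of all families whose $\lambda$-th entry is $0$ for every $\lambda\notin U$. Let $\lambda_1$ denote the first entry of $\lambda$ (with $\lambda_1=0$ if $\lambda$ is empty). Then $$T_{\operatorname{sign}}(\mathcal{J}_{n-k-1})=\mathcal{A}_{\{\lambda\vdash n\,\mid\,\lambda_1\ge n-k\}}.$$ Moreover, if $n\ge 1$ or $k=0$, then $$\operatorname{span}_{\mathbf{k}}\{\nabla_{\mathbf{b},\mathbf{a}}\mid \mathbf{a},\mathbf{b}\in[n]^k\}=\mathcal{A}_{\{\lambda\vdash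 n\,\mid\,\lambda_1\ge n-k\}}.$$ -/

import Mathlib

noncomputable section

namespace SymGroupAlg

open Equiv

/-- The group algebra `𝒜 = R[S_n]`; `S_n` is the group of permutations of `Fin n`. -/
abbrev GroupAlg (R : Type*) [CommRing R] (n : ℕ) : Type _ :=
  MonoidAlgebra R (Perm (Fin n))

section Ideals

variable (R : Type*) [CommRing R] {n : ℕ}

/-- A permutation, regarded as an element of the group algebra. -/
def perm (w : Perm (Fin n)) : GroupAlg R n :=
  MonoidAlgebra.of R (Perm (Fin n)) w

/-- The sign `(-1)^w`, as an element of `R`. -/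
def sgn (w : Perm (Fin n)) : R :=
  ((Perm.sign w : ℤ) : R)

/-- The antisymmetrizer `∇_U⁻`: the sum of `(-1)^w w` over all permutations `w` that fix every
element outside `U`. -/
def antisymmetrizer (U : Finset (Fin n)) : GroupAlg R n :=
  ∑ w : Perm (Fin n) with ∀ i, i ∉ U → w i = i, sgn R w • perm R w

/-- The ideal `𝒥_k = 𝒜 · span {∇_U⁻ | U ⊆ [n], |U| = k + 1} · 𝒜` for a natural number `k`. -/
def idealJNat (n k : ℕ) : Submodule R (GroupAlg R n) :=
  ⊤ * Submodule.span R {x | ∃ U : Finset (Fin n), U.card = k + 1 ∧ x = antisymmetrizer R U} * ⊤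

/-- The ideal `𝒥_m` for an integer `m`, with the convention `𝒥_m = 𝒜` for `m < 0`. -/
def idealJ (n : ℕ) (m : ℤ) : Submodule R (GroupAlg R n) :=
  if m < 0 then ⊤ else idealJNat R n m.toNat

/-- The sign-twist `T_sign`: the algebra endomorphism that sends each permutation `w` to `(-1)^w w`. -/
def signTwist (n : ℕ) : GroupAlg R n →ₐ[R] GroupAlg R n :=
  MonoidAlgebra.lift R (GroupAlg R n) (Perm (Fin n))
    { toFun := fun w => sgn R w • perm R w
      map_one' := by simp [sgn, perm, MonoidAlgebra.one_def]
      map_mul' := fun v w => by simp [sgn, perm] }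

/-- `∇_{b,a}`: the sum of all permutations `w` with `w (a i) = b i` for all `i`. -/
def tupleSum {k : ℕ} (b a : Fin k → Fin n) : GroupAlg R n :=
  ∑ w : Perm (Fin n) with ∀ i, w (a i) = b i, perm R w

end Ideals

section Partitions

variable {n : ℕ}

/-- The entries `λ_1 ≥ λ_2 ≥ ⋯ ≥ λ_ℓ > 0` of a partition, in weakly decreasing order. -/
def entries (μ : n.Partition) : List ℕ :=
  μ.parts.sort (· ≥ ·)

theorem sortedGE_entries (μ : n.Partition) : (entries μ).SortedGE :=
  (Multiset.pairwise_sort μ.parts (· ≥ ·)).sortedGE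

/-- The first entry `λ_1` of a partition (`0` for the empty partition). -/
def firstEntry (μ : n.Partition) : ℕ :=
  (entries μ).headD 0

/-- The Young diagram of a partition: row `i` has `λ_{i+1}` cells `(i, 0), (i, 1), …`. -/
def diagram (μ : n.Partition) : YoungDiagram :=
  YoungDiagram.ofRowLens (entries μ) (sortedGE_entries μ)

theorem card_cellsOfRowLens (w : List ℕ) : (YoungDiagram.cellsOfRowLens w).card = w.sum := by
  induction w with
  | nil => rfl
  | cons a w ih =>
    rw [YoungDiagram.cellsOfRowLens, Finset.card_union_of_disjoint, Finset.card_map, ih]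
    · simp
    · simp [Finset.disjoint_left]

theorem card_diagram (μ : n.Partition) : (diagram μ).card = n := by
  refine (card_cellsOfRowLens (entries μ)).trans ?_
  rw [← Multiset.sum_coe, entries, Multiset.sort_eq, μ.parts_sum]

/-- The cells of the Young diagram, ordered row by row from the top and from left to right. -/
def lexCells (μ : n.Partition) : Finset (ℕ ×ₗ ℕ) :=
  (diagram μ).cells.map toLex.toEmbedding

theorem card_lexCells (μ : n.Partition) : (lexCells μ).card = n := by
  rw [lexCells, Finset.card_map]
  exact card_diagram μ

/-- The tableau `T_λ` of shape `λ` whose entries `1, …, n` are filled in row by row, starting with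
the top row: the cell `(row, column)` that contains a given entry. -/
def rowTableau (μ : n.Partition) (m : Fin n) : ℕ × ℕ :=
  ofLex ((lexCells μ).orderEmbOfFin (card_lexCells μ) m)

end Partitions

section Specht

variable (R : Type*) [CommRing R] {n : ℕ}

/-- The row symmetrizer `a_λ` of `T_λ`: the sum of all permutations that preserve the rows of
`T_λ` as sets. -/
def rowSymmetrizer (μ : n.Partition) : GroupAlg R n :=
  ∑ w : Perm (Fin n) with ∀ m, (rowTableau μ (w m)).1 = (rowTableau μ m).1, perm R w

/-- The column antisymmetrizer `b_λ` of `T_λ`: the sum of `(-1)^w w` over all permutations `w`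
that preserve the columns of `T_λ` as sets. -/
def colAntisymmetrizer (μ : n.Partition) : GroupAlg R n :=
  ∑ w : Perm (Fin n) with ∀ m, (rowTableau μ (w m)).2 = (rowTableau μ m).2, sgn R w • perm R w

/-- The Specht module `S^λ = 𝒜 a_λ b_λ`, a left ideal of the group algebra. -/
def specht (μ : n.Partition) : Submodule (GroupAlg R n) (GroupAlg R n) :=
  Submodule.span (GroupAlg R n) {rowSymmetrizer R μ * colAntisymmetrizer R μ}

/-- The map `AW : 𝒜 → ∏_{λ ⊢ n} End (S^λ)`, which sends `a` to the family of the actions of `a`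
on the Specht modules. -/
def AW (n : ℕ) :
    GroupAlg R n →ₐ[R] ((μ : n.Partition) → Module.End R (specht R μ)) :=
  AlgHom.pi fun μ => Algebra.lsmul R R (specht R μ)

/-- The subproduct `∏_{λ ∈ U} End (S^λ)` of `∏_{λ ⊢ n} End (S^λ)`: the families whose `λ`-th entry
is `0` for all `λ ∉ U`. -/
def subproduct (U : Set n.Partition) :
    Submodule R ((μ : n.Partition) → Module.End R (specht R μ)) :=
  Submodule.pi Uᶜ fun _ => ⊥

/-- `𝒜_U`: the preimage of the subproduct `∏_{λ ∈ U} End (S^λ)` under `AW`. -/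
def preimageAW (U : Set n.Partition) : Submodule R (GroupAlg R n) :=
  (subproduct R U).comap (AW R n).toLinearMap

end Specht

end SymGroupAlg

end

/-!
The sign twist turns the antisymmetrizers into the symmetrizers `∇_U`, and so `𝒥_{n-k-1}` into the
ideal `I` generated by the `∇_U` with `|U| = n - k`. When `k ≥ n`, everything in sight is the whole
algebra (apart from the span of the `∇_{b,a}` in the excluded case `n = 0 < k`). Otherwise let `S`
be the span of the `∇_{b,a}` and `K` the preimage under `AW`. Then
`I ⊆ S ⊆ K ⊆ I`.

* `I ⊆ S`, because `u ∇_U v` is itself some `∇_{b,a}` (`symmetrizerIdeal_le_span_tupleSum`).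
* `S ⊆ K`, because `∇_{b,a}` is invariant under the permutations of at least `n - k` entries, and
  two of them share a column as soon as `μ_1 < n - k`; their transposition then acts by `1` and by
  `-1` (`span_tupleSum_le_preimageAW`).
* `K ⊆ I` rests on the identity `n!² = ∑_μ f_μ² ∑_w w a_μ b_μ w⁻¹` with natural numbers `f_μ`
  (`exists_factorial_sq_smul_one_eq`). Multiply it by an element `x` of `K`: the terms with
  `μ_1 < n - k` vanish, and the other ones lie in `I`, since `a_μ` does
  (`rowSymmetrizer_mem_symmetrizerIdeal`).

The identity need only be proved over `ℚ`. By the combinatorics of tableaux (`rowsBelow_le`,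
`exists_row_mul_col`), `a_μ 𝒜 b_ν` vanishes unless `ν` dominates `μ`, and `a_μ 𝒜 b_μ` is spanned by
`a_μ b_μ`. So the central elements `c_μ = ∑_w w a_μ b_μ w⁻¹` are pairwise orthogonal, and
`c_μ² = κ_μ² c_μ`, where `(a_μ b_μ)² = κ_μ a_μ b_μ`. There are as many of them as conjugacy classes,
hence they span the center and `1 = ∑_μ κ_μ⁻² c_μ`. Finally `n! / κ_μ` is a natural number, being
the rank of right multiplication by the idempotent `κ_μ⁻¹ a_μ b_μ`.
-/

noncomputable section

namespace SymGroupAlg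

open Equiv

/-! ### Tableaux and dominance -/

section Tableaux

variable {n : ℕ}

theorem rowTableau_injective (μ : n.Partition) : Function.Injective (rowTableau μ) := fun _ _ h =>
  ((lexCells μ).orderEmbOfFin (card_lexCells μ)).injective (ofLex.injective h)

theorem mem_cells_iff_exists_rowTableau (μ : n.Partition) {c : ℕ × ℕ} :
    c ∈ (diagram μ).cells ↔ ∃ m, rowTableau μ m = c := by
  have h := (lexCells μ).range_orderEmbOfFin (card_lexCells μ)
  have h' := Set.ext_iff.1 h (toLex c)
  simp only [Set.mem_range, lexCells, Finset.coe_map, Set.mem_image, Finset.mem_coe,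
    Equiv.coe_toEmbedding, EmbeddingLike.apply_eq_iff_eq, exists_eq_right] at h'
  rw [← h']
  rfl

theorem rowTableau_mem (μ : n.Partition) (m : Fin n) : rowTableau μ m ∈ diagram μ :=
  (mem_cells_iff_exists_rowTableau μ).2 ⟨m, rfl⟩

theorem exists_rowTableau_eq (μ : n.Partition) {c : ℕ × ℕ} (hc : c ∈ diagram μ) :
    ∃ m, rowTableau μ m = c :=
  (mem_cells_iff_exists_rowTableau μ).1 hc

/-- The number of entries of `T_μ` in the rows `0, …, k - 1`, that is `μ_1 + ⋯ + μ_k`. The dominance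
order compares these numbers. -/
def rowsBelow (μ : n.Partition) (k : ℕ) : ℕ :=
  Finset.card {m | (rowTableau μ m).1 < k}

/-- If an injective placement `F` of `1, …, n` in the plane has the same column sizes as `T_μ`,
then no column of `F` has more cells above row `k` than that column of `T_μ`, because the columns
of `T_μ` are justified to the top. -/
theorem card_fiber_le (μ : n.Partition) (v : Perm (Fin n)) {F : Fin n → ℕ × ℕ}
    (hF : Function.Injective F) (hcol : ∀ m, (F m).2 = (rowTableau μ (v m)).2) (k c : ℕ) :
    Finset.card {m | (F m).1 < k ∧ (F m).2 = c} ≤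
      Finset.card {m | (rowTableau μ m).1 < k ∧ (rowTableau μ m).2 = c} := by
  by_cases h : ∀ m, (rowTableau μ m).2 = c → (rowTableau μ m).1 < k
  · refine Finset.card_le_card_of_injOn v (fun m hm => ?_) v.injective.injOn
    simp only [Finset.coe_filter, Finset.mem_univ, true_and, Set.mem_ofPred_eq] at hm ⊢
    rw [hcol] at hm
    exact ⟨h _ hm.2, hm.2⟩
  · push Not at h
    obtain ⟨m₀, rfl, h₀⟩ := h
    calc _ ≤ (Finset.range k).card := by
          refine Finset.card_le_card_of_injOn (fun m => (F m).1) (fun m hm => ?_) ?_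
          · simp at hm
            simpa using hm.1
          · intro a ha b hb hab
            simp only [Finset.coe_filter, Finset.mem_univ, true_and, Set.mem_ofPred_eq] at ha hb
            exact hF (Prod.ext hab (ha.2.trans hb.2.symm))
      _ ≤ _ := by
          have hex : ∀ r ∈ Finset.range k, ∃ m, rowTableau μ m = (r, (rowTableau μ m₀).2) := by
            intro r hr
            refine exists_rowTableau_eq μ ((diagram μ).up_left_mem ?_ le_rfl (rowTableau_mem μ m₀))
            exact (Finset.mem_range.1 hr).le.trans h₀
          have hne := Nonempty.intro m₀
          choose! g hg using hex
          refine Finset.card_le_card_of_injOn g (fun r hr => ?_) fun r hr s hs hrs => ?_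
          · simp [hg r hr, Finset.mem_range.1 hr]
          · have := (hg r hr).symm.trans ((congrArg _ hrs).trans (hg s hs))
            exact congrArg Prod.fst this

theorem card_filter_eq_sum_columns (μ : n.Partition) (v : Perm (Fin n)) {F : Fin n → ℕ × ℕ}
    (hcol : ∀ m, (F m).2 = (rowTableau μ (v m)).2) (k : ℕ) :
    Finset.card {m | (F m).1 < k} =
      ∑ c ∈ Finset.univ.image fun m => (rowTableau μ m).2,
        Finset.card {m | (F m).1 < k ∧ (F m).2 = c} := by
  rw [Finset.card_eq_sum_card_fiberwise (f := fun m => (F m).2)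
    (t := Finset.univ.image fun m => (rowTableau μ m).2)]
  · simp [Finset.filter_filter]
  · intro m _
    simp [hcol]

theorem card_le_rowsBelow (μ : n.Partition) (v : Perm (Fin n)) {F : Fin n → ℕ × ℕ}
    (hF : Function.Injective F) (hcol : ∀ m, (F m).2 = (rowTableau μ (v m)).2) (k : ℕ) :
    Finset.card {m | (F m).1 < k} ≤ rowsBelow μ k := by
  rw [card_filter_eq_sum_columns μ v hcol, rowsBelow,
    card_filter_eq_sum_columns μ 1 (F := rowTableau μ) fun _ => rfl]
  exact Finset.sum_le_sum fun c _ => card_fiber_le μ v hF hcol k c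

/-- In the equality case of `card_le_rowsBelow` the placement fills the Young diagram. -/
theorem mem_diagram_of_card_eq (μ : n.Partition) (v : Perm (Fin n)) {F : Fin n → ℕ × ℕ}
    (hF : Function.Injective F) (hcol : ∀ m, (F m).2 = (rowTableau μ (v m)).2)
    (h : ∀ k, Finset.card {m | (F m).1 < k} = rowsBelow μ k) (m : Fin n) : F m ∈ diagram μ := by
  have key (k : ℕ) : Finset.card {m' | (F m').1 < k ∧ (F m').2 = (F m).2} =
      Finset.card {m' | (rowTableau μ m').1 < k ∧ (rowTableau μ m').2 = (F m).2} := by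
    have hk := h k
    rw [card_filter_eq_sum_columns μ v hcol, rowsBelow,
      card_filter_eq_sum_columns μ 1 (F := rowTableau μ) fun _ => rfl] at hk
    exact (Finset.sum_eq_sum_iff_of_le fun c _ => card_fiber_le μ v hF hcol k c).1 hk _
      (by simp [hcol])
  have hlt : Finset.card {m' | (F m').1 < (F m).1 ∧ (F m').2 = (F m).2} <
      Finset.card {m' | (F m').1 < (F m).1 + 1 ∧ (F m').2 = (F m).2} := by
    refine Finset.card_lt_card ⟨fun x hx => ?_, fun hx => ?_⟩
    · simp at hx ⊢
      exact ⟨by lia, hx.2⟩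
    · simpa using @hx m (by simp)
  rw [key, key] at hlt
  by_contra hm
  refine hlt.not_ge (Finset.card_le_card fun x hx => ?_)
  simp only [Finset.mem_filter, Finset.mem_univ, true_and] at hx ⊢
  refine ⟨(Nat.lt_succ_iff.1 hx.1).lt_of_ne fun he => hm ?_, hx.2⟩
  rw [← Prod.ext (y := F m) he hx.2]
  exact rowTableau_mem μ x

theorem rowLens_diagram (μ : n.Partition) : (diagram μ).rowLens = entries μ := by
  refine YoungDiagram.rowLens_ofRowLens_eq_self fun x hx => ?_
  exact μ.parts_pos ((Multiset.mem_sort _).1 hx)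

theorem card_row (μ : n.Partition) (r : ℕ) :
    Finset.card {m | (rowTableau μ m).1 = r} = (diagram μ).rowLen r := by
  rw [YoungDiagram.rowLen_eq_card]
  refine Finset.card_nbij (rowTableau μ) (fun m hm => ?_) (rowTableau_injective μ).injOn ?_
  · simpa [YoungDiagram.mem_row_iff, rowTableau_mem] using hm
  · intro c hc
    have hc := YoungDiagram.mem_row_iff.1 hc
    obtain ⟨m, rfl⟩ := exists_rowTableau_eq μ hc.1
    exact ⟨m, by simpa using hc.2, rfl⟩

theorem rowsBelow_injective {μ ν : n.Partition} (h : ∀ k, rowsBelow μ k = rowsBelow ν k) :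
    μ = ν := by
  have hsucc (μ : n.Partition) (k : ℕ) :
      rowsBelow μ (k + 1) = rowsBelow μ k + (diagram μ).rowLen k := by
    rw [← card_row, rowsBelow, rowsBelow, ← Finset.card_union_of_disjoint]
    · congr 1
      ext m
      simp [le_iff_lt_or_eq]
    · rw [Finset.disjoint_filter]
      intro m _ h1 h2
      lia
  have hrow (k : ℕ) : (diagram μ).rowLen k = (diagram ν).rowLen k := by
    have h1 := hsucc μ k
    have h2 := hsucc ν k
    rw [h, h] at h1
    lia
  have hd : diagram μ = diagram ν := by
    ext ⟨i, j⟩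
    simp [YoungDiagram.mem_iff_lt_rowLen, hrow]
  have he : entries μ = entries ν := by rw [← rowLens_diagram, hd, rowLens_diagram]
  ext1
  rw [← Multiset.sort_eq μ.parts (· ≥ ·), ← Multiset.sort_eq ν.parts (· ≥ ·)]
  exact congrArg _ he

theorem firstEntry_eq_rowLen (μ : n.Partition) : firstEntry μ = (diagram μ).rowLen 0 := by
  rw [firstEntry, ← rowLens_diagram, YoungDiagram.rowLens]
  cases h : (diagram μ).colLen 0 with
  | zero =>
    have : ¬ (0, 0) ∈ diagram μ := by rw [YoungDiagram.mem_iff_lt_colLen, h]; simp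
    rw [YoungDiagram.mem_iff_lt_rowLen] at this
    simp; lia
  | succ k => simp [List.range_succ_eq_map]

theorem rowTableau_snd_lt (μ : n.Partition) (m : Fin n) : (rowTableau μ m).2 < firstEntry μ := by
  rw [firstEntry_eq_rowLen, ← YoungDiagram.mem_iff_lt_rowLen]
  exact (diagram μ).up_left_mem (Nat.zero_le _) le_rfl (rowTableau_mem μ m)

/-- If no two distinct entries share both a row of `T_μ` and a column of `w T_ν`, then `ν`
dominates `μ`. -/
theorem rowsBelow_le {μ ν : n.Partition} {w : Perm (Fin n)}
    (h : Function.Injective fun m => ((rowTableau μ m).1, (rowTableau ν (w⁻¹ m)).2)) (k : ℕ) :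
    rowsBelow μ k ≤ rowsBelow ν k :=
  card_le_rowsBelow ν w⁻¹ h (fun _ => rfl) k

/-- If no two distinct entries share both a row of `T_μ` and a column of `w T_μ`, then `w` is the
product of a permutation preserving the rows and one preserving the columns of `T_μ`. -/
theorem exists_row_mul_col {μ : n.Partition} {w : Perm (Fin n)}
    (h : Function.Injective fun m => ((rowTableau μ m).1, (rowTableau μ (w⁻¹ m)).2)) :
    ∃ u v : Perm (Fin n), (∀ m, (rowTableau μ (u m)).1 = (rowTableau μ m).1) ∧
      (∀ m, (rowTableau μ (v m)).2 = (rowTableau μ m).2) ∧ w = u * v := by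
  have hmem := mem_diagram_of_card_eq μ w⁻¹ h (fun _ => rfl) fun k => rfl
  choose g hg using fun m => exists_rowTableau_eq μ (hmem m)
  have ginj : Function.Injective g := fun a b hab => h (by
    have := congrArg (rowTableau μ) hab
    rwa [hg, hg] at this)
  let u := Equiv.ofBijective g (Finite.injective_iff_bijective.1 ginj)
  have hu (m) : rowTableau μ (u m) = ((rowTableau μ m).1, (rowTableau μ (w⁻¹ m)).2) := hg m
  refine ⟨u⁻¹, u * w, fun m => ?_, fun m => ?_, by group⟩
  · have := hu (u⁻¹ m)
    rw [← Perm.mul_apply, mul_inv_cancel] at this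
    exact (congrArg Prod.fst this).symm
  · simp [hu]

end Tableaux

/-! ### Multiplication rules for symmetrizers -/

section Symmetrizers

variable (R : Type*) [CommRing R] {n : ℕ}

theorem perm_mul_perm (v w : Perm (Fin n)) : perm R v * perm R w = perm R (v * w) :=
  (map_mul _ _ _).symm

theorem perm_one : perm R (1 : Perm (Fin n)) = 1 :=
  map_one _

theorem sgn_mul (v w : Perm (Fin n)) : sgn R (v * w) = sgn R v * sgn R w := by
  simp [sgn]

theorem sgn_mul_self (v : Perm (Fin n)) : sgn R v * sgn R v = 1 := by
  rw [← sgn_mul, sgn, map_mul, Int.units_mul_self]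
  simp

theorem sgn_swap {i j : Fin n} (h : i ≠ j) : sgn R (swap i j) = -1 := by
  simp [sgn, Perm.sign_swap h]

theorem coeff_perm (v w : Perm (Fin n)) : (perm R v).coeff w = if v = w then 1 else 0 := by
  simp [perm, Finsupp.single_apply]

theorem coeff_perm_mul (v w : Perm (Fin n)) (x : GroupAlg R n) :
    (perm R v * x).coeff w = x.coeff (v⁻¹ * w) := by
  rw [perm, MonoidAlgebra.of_apply,
    MonoidAlgebra.coeff_single_mul_eq_mul_coeff (v⁻¹ * w), one_mul]
  intro u _
  rw [eq_inv_mul_iff_mul_eq]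

theorem coeff_mul_perm (v w : Perm (Fin n)) (x : GroupAlg R n) :
    (x * perm R v).coeff w = x.coeff (w * v⁻¹) := by
  rw [perm, MonoidAlgebra.of_apply,
    MonoidAlgebra.coeff_mul_single_eq_coeff_mul (w * v⁻¹), mul_one]
  intro u _
  rw [eq_mul_inv_iff_mul_eq]

theorem eq_sum_coeff_smul_perm (x : GroupAlg R n) : x = ∑ w, x.coeff w • perm R w := by
  ext w
  simp [Finsupp.finsetSum_apply, coeff_perm]

/-- The coefficient of the identity is a trace form on the group algebra. -/
theorem coeff_one_mul_comm (x y : GroupAlg R n) : (x * y).coeff 1 = (y * x).coeff 1 := by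
  rw [eq_sum_coeff_smul_perm R x, Finset.sum_mul, Finset.mul_sum]
  simp [Finsupp.finsetSum_apply, coeff_perm_mul, coeff_mul_perm]

/-- The sum of a set of permutations absorbs, on the right, a permutation under which the set is
stable. -/
theorem sum_perm_mul_perm {p : Perm (Fin n) → Prop} [DecidablePred p] {v : Perm (Fin n)}
    (hv : ∀ w, p (w * v) ↔ p w) : (∑ w with p w, perm R w) * perm R v = ∑ w with p w, perm R w := by
  simp_rw [Finset.sum_mul, perm_mul_perm]
  exact Finset.sum_equiv (Equiv.mulRight v) (by simp [hv]) (by simp)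

theorem rowSymmetrizer_mul_perm (μ : n.Partition) {v : Perm (Fin n)}
    (hv : ∀ m, (rowTableau μ (v m)).1 = (rowTableau μ m).1) :
    rowSymmetrizer R μ * perm R v = rowSymmetrizer R μ := by
  refine sum_perm_mul_perm R fun w => ⟨fun h m => ?_, fun h m => ?_⟩
  · have h1 := h (v⁻¹ m)
    have h2 := hv (v⁻¹ m)
    simp only [Perm.mul_apply, ← Perm.mul_apply v, mul_inv_cancel, Perm.one_apply] at h1 h2
    rw [h1, h2]
  · rw [Perm.mul_apply, h, hv]

theorem perm_mul_colAntisymmetrizer (μ : n.Partition) {v : Perm (Fin n)}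
    (hv : ∀ m, (rowTableau μ (v m)).2 = (rowTableau μ m).2) :
    perm R v * colAntisymmetrizer R μ = sgn R v • colAntisymmetrizer R μ := by
  simp_rw [colAntisymmetrizer, Finset.mul_sum, Finset.smul_sum, mul_smul_comm, perm_mul_perm,
    smul_smul]
  refine Finset.sum_equiv (Equiv.mulLeft v) (by simp [hv]) fun w _ => ?_
  simp only [coe_mulLeft, sgn_mul, ← mul_assoc, sgn_mul_self, one_mul]

theorem swap_preserves {α : Type*} {f : Fin n → α} {i j : Fin n} (h : f i = f j) (m : Fin n) :
    f (swap i j m) = f m := by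
  rw [swap_apply_def]
  split_ifs with h1 h2
  · rw [h1, h]
  · rw [h2, h]
  · rfl

/-- If `x` is invariant under the transposition of two entries which `w⁻¹` places in one column of
`T_μ`, then the product vanishes: the transposition acts by `1` from one side and by `-1` from the
other. -/
theorem mul_perm_mul_colAntisymmetrizer_eq_zero (h2 : IsUnit (2 : R)) (μ : n.Partition)
    {w : Perm (Fin n)} {i j : Fin n} (hij : i ≠ j)
    (hcol : (rowTableau μ (w⁻¹ i)).2 = (rowTableau μ (w⁻¹ j)).2) {x : GroupAlg R n}
    (hx : x * perm R (swap i j) = x) : x * perm R w * colAntisymmetrizer R μ = 0 := by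
  have h1 : x * perm R w * colAntisymmetrizer R μ =
      -(x * perm R w * colAntisymmetrizer R μ) := by
    calc _ = x * perm R (swap i j * w) * colAntisymmetrizer R μ := by
          rw [← perm_mul_perm, ← mul_assoc, hx]
      _ = x * perm R w * (perm R (swap (w⁻¹ i) (w⁻¹ j)) * colAntisymmetrizer R μ) := by
          rw [Equiv.swap_mul_eq_mul_swap, ← perm_mul_perm]
          simp only [mul_assoc]
      _ = _ := by
          rw [perm_mul_colAntisymmetrizer R μ
              (swap_preserves (f := fun m => (rowTableau μ m).2) hcol),
            sgn_swap R (by simpa using hij)]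
          simp
  have h3 : (2 : R) • (x * perm R w * colAntisymmetrizer R μ) = 0 := by
    rw [two_smul]
    nth_rewrite 1 [h1]
    exact neg_add_cancel _
  exact (h2.smul_eq_zero).1 h3

theorem rowSymmetrizer_mul_perm_mul_eq_zero (h2 : IsUnit (2 : R)) {μ ν : n.Partition}
    {w : Perm (Fin n)}
    (h : ¬ Function.Injective fun m => ((rowTableau μ m).1, (rowTableau ν (w⁻¹ m)).2)) :
    rowSymmetrizer R μ * perm R w * colAntisymmetrizer R ν = 0 := by
  simp only [Function.Injective, not_forall, Prod.mk.injEq] at h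
  obtain ⟨i, j, ⟨hr, hc⟩, hij⟩ := h
  exact mul_perm_mul_colAntisymmetrizer_eq_zero R h2 ν hij hc
    (rowSymmetrizer_mul_perm R μ (swap_preserves (f := fun m => (rowTableau μ m).1) hr))

theorem rowSymmetrizer_mul_mul_eq_zero (h2 : IsUnit (2 : R)) {μ ν : n.Partition}
    (h : ¬ ∀ k, rowsBelow μ k ≤ rowsBelow ν k) (x : GroupAlg R n) :
    rowSymmetrizer R μ * x * colAntisymmetrizer R ν = 0 := by
  rw [eq_sum_coeff_smul_perm R x, Finset.mul_sum, Finset.sum_mul]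
  refine Finset.sum_eq_zero fun w _ => ?_
  rw [mul_smul_comm, smul_mul_assoc,
    rowSymmetrizer_mul_perm_mul_eq_zero R h2 fun hi => h (rowsBelow_le hi), smul_zero]

/-- The Young symmetrizer `a_μ b_μ`. -/
def youngSymmetrizer (μ : n.Partition) : GroupAlg R n :=
  rowSymmetrizer R μ * colAntisymmetrizer R μ

/-- Only the pair `(1, 1)` contributes, as a permutation that preserves the rows and the columns
of `T_μ` is the identity. -/
theorem coeff_one_youngSymmetrizer (μ : n.Partition) : (youngSymmetrizer R μ).coeff 1 = 1 := by
  have hinj := rowTableau_injective μ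
  simp only [youngSymmetrizer, rowSymmetrizer, colAntisymmetrizer, Finset.sum_mul,
    MonoidAlgebra.coeff_sum, Finsupp.finsetSum_apply, coeff_perm_mul, MonoidAlgebra.coeff_smul,
    Finsupp.smul_apply, coeff_perm, mul_one]
  rw [Finset.sum_eq_single_of_mem 1 (by simp), Finset.sum_eq_single_of_mem 1 (by simp)]
  · simp [sgn]
  · intro v _ hv
    simp [hv]
  · intro u hu hu1
    refine Finset.sum_eq_zero fun v hv => ?_
    rw [if_neg, smul_zero]
    rintro rfl
    refine hu1 (Equiv.ext fun m => hinj (Prod.ext ((Finset.mem_filter.1 hu).2 m) ?_))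
    have := (Finset.mem_filter.1 hv).2 (u m)
    simpa using this.symm

/-- Von Neumann's lemma: `a_μ 𝒜 b_μ` is spanned by `a_μ b_μ`. -/
theorem rowSymmetrizer_mul_mul_eq_smul (h2 : IsUnit (2 : R)) (μ : n.Partition)
    (x : GroupAlg R n) : ∃ r : R,
      rowSymmetrizer R μ * x * colAntisymmetrizer R μ = r • youngSymmetrizer R μ := by
  have hw (w : Perm (Fin n)) : ∃ r : R,
      rowSymmetrizer R μ * perm R w * colAntisymmetrizer R μ = r • youngSymmetrizer R μ := by
    by_cases h : Function.Injective fun m => ((rowTableau μ m).1, (rowTableau μ (w⁻¹ m)).2)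
    · obtain ⟨u, v, hu, hv, rfl⟩ := exists_row_mul_col h
      refine ⟨sgn R v, ?_⟩
      rw [← perm_mul_perm, ← mul_assoc, rowSymmetrizer_mul_perm R μ hu, mul_assoc,
        perm_mul_colAntisymmetrizer R μ hv, mul_smul_comm, youngSymmetrizer]
    · exact ⟨0, by rw [rowSymmetrizer_mul_perm_mul_eq_zero R h2 h, zero_smul]⟩
  choose r hr using hw
  refine ⟨∑ w, x.coeff w * r w, ?_⟩
  nth_rewrite 1 [eq_sum_coeff_smul_perm R x]
  simp only [Finset.mul_sum, Finset.sum_mul, mul_smul_comm, smul_mul_assoc, hr, smul_smul,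
    Finset.sum_smul]

theorem youngSymmetrizer_mul_mul_self (h2 : IsUnit (2 : R)) (μ : n.Partition)
    (x : GroupAlg R n) : youngSymmetrizer R μ * x * youngSymmetrizer R μ =
      (youngSymmetrizer R μ * x * youngSymmetrizer R μ).coeff 1 • youngSymmetrizer R μ := by
  obtain ⟨r, hr⟩ := rowSymmetrizer_mul_mul_eq_smul R h2 μ
    (colAntisymmetrizer R μ * x * rowSymmetrizer R μ)
  have : youngSymmetrizer R μ * x * youngSymmetrizer R μ = r • youngSymmetrizer R μ := by
    rw [← hr]
    simp only [youngSymmetrizer, mul_assoc]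
  rw [this, MonoidAlgebra.coeff_smul_apply, coeff_one_youngSymmetrizer, smul_eq_mul, mul_one]

/-- The sum of the conjugates of the Young symmetrizer, which is central in `𝒜`. -/
def conjSum (μ : n.Partition) : GroupAlg R n :=
  ∑ w, perm R w * youngSymmetrizer R μ * perm R w⁻¹

theorem perm_mul_conjSum (μ : n.Partition) (v : Perm (Fin n)) :
    perm R v * conjSum R μ = conjSum R μ * perm R v := by
  rw [conjSum, Finset.mul_sum, Finset.sum_mul]
  refine Finset.sum_equiv (Equiv.mulLeft v) (by simp) fun w _ => ?_
  simp only [coe_mulLeft, mul_inv_rev, ← perm_mul_perm, mul_assoc]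
  rw [perm_mul_perm R v⁻¹ v, inv_mul_cancel, perm_one, mul_one]

theorem mul_conjSum_comm (μ : n.Partition) (x : GroupAlg R n) :
    x * conjSum R μ = conjSum R μ * x := by
  rw [eq_sum_coeff_smul_perm R x]
  simp only [Finset.mul_sum, Finset.sum_mul, mul_smul_comm, smul_mul_assoc, perm_mul_conjSum]

theorem coeff_one_conjSum (μ : n.Partition) : (conjSum R μ).coeff 1 = (n.factorial : R) := by
  have (w : Perm (Fin n)) : w⁻¹ * (1 * w⁻¹⁻¹) = 1 := by group
  simp only [conjSum, MonoidAlgebra.coeff_sum, Finsupp.finsetSum_apply, coeff_mul_perm,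
    coeff_perm_mul, this, coeff_one_youngSymmetrizer]
  simp [Fintype.card_perm]

theorem conjSum_mul_conjSum_eq_zero (h2 : IsUnit (2 : R)) {μ ν : n.Partition} (h : μ ≠ ν) :
    conjSum R μ * conjSum R ν = 0 := by
  have key {μ ν : n.Partition} (h : ¬ ∀ k, rowsBelow μ k ≤ rowsBelow ν k) :
      conjSum R μ * conjSum R ν = 0 := by
    nth_rewrite 1 [conjSum]
    rw [conjSum, Finset.sum_mul]
    refine Finset.sum_eq_zero fun v _ => ?_
    rw [Finset.mul_sum]
    refine Finset.sum_eq_zero fun w _ => ?_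
    have := rowSymmetrizer_mul_mul_eq_zero R h2 h (colAntisymmetrizer R μ * perm R v⁻¹ *
      perm R w * rowSymmetrizer R ν)
    calc _ = perm R v * (rowSymmetrizer R μ * (colAntisymmetrizer R μ * perm R v⁻¹ *
          perm R w * rowSymmetrizer R ν) * colAntisymmetrizer R ν) * perm R w⁻¹ := by
            simp only [youngSymmetrizer, mul_assoc]
      _ = 0 := by rw [this, mul_zero, zero_mul]
  by_cases h' : ∀ k, rowsBelow μ k ≤ rowsBelow ν k
  · rw [mul_conjSum_comm]
    exact key fun h'' => h (rowsBelow_injective fun k => (h' k).antisymm (h'' k))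
  · exact key h'

/-- The scalar `κ` with `(a_μ b_μ)² = κ a_μ b_μ` (the product of the hook lengths of `μ`), obtained
as the coefficient of the identity, which in `a_μ b_μ` is `1`. -/
def hookProduct (μ : n.Partition) : R :=
  (youngSymmetrizer R μ * youngSymmetrizer R μ).coeff 1

theorem youngSymmetrizer_mul_self (h2 : IsUnit (2 : R)) (μ : n.Partition) :
    youngSymmetrizer R μ * youngSymmetrizer R μ = hookProduct R μ • youngSymmetrizer R μ := by
  simpa [hookProduct] using youngSymmetrizer_mul_mul_self R h2 μ 1

/-- The scalar by which `w⁻¹` is compressed by the Young symmetrizer is a coefficient of the Young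
symmetrizer, which makes the sum over `w` collapse. -/
theorem conjSum_mul_youngSymmetrizer (h2 : IsUnit (2 : R)) (μ : n.Partition) :
    conjSum R μ * youngSymmetrizer R μ = hookProduct R μ ^ 2 • youngSymmetrizer R μ := by
  have hw (w : Perm (Fin n)) : perm R w * youngSymmetrizer R μ * perm R w⁻¹ *
      youngSymmetrizer R μ = hookProduct R μ • ((youngSymmetrizer R μ).coeff w • perm R w) *
        youngSymmetrizer R μ := by
    rw [mul_assoc, mul_assoc, ← mul_assoc (youngSymmetrizer R μ),
      youngSymmetrizer_mul_mul_self R h2, coeff_one_mul_comm, ← mul_assoc,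
      youngSymmetrizer_mul_self R h2, smul_mul_assoc, MonoidAlgebra.coeff_smul_apply,
      coeff_mul_perm]
    simp [smul_smul]
  rw [conjSum, Finset.sum_mul, Finset.sum_congr rfl fun w _ => hw w, ← Finset.sum_mul,
    ← Finset.smul_sum, ← eq_sum_coeff_smul_perm, smul_mul_assoc,
    youngSymmetrizer_mul_self R h2, smul_smul, sq]

theorem conjSum_mul_self (h2 : IsUnit (2 : R)) (μ : n.Partition) :
    conjSum R μ * conjSum R μ = hookProduct R μ ^ 2 • conjSum R μ := by
  nth_rewrite 2 [conjSum]
  rw [Finset.mul_sum, conjSum, Finset.smul_sum]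
  refine Finset.sum_congr rfl fun w _ => ?_
  rw [← conjSum, ← mul_assoc, ← mul_assoc, ← perm_mul_conjSum, mul_assoc (perm R w),
    conjSum_mul_youngSymmetrizer R h2, mul_smul_comm, smul_mul_assoc]

end Symmetrizers

/-! ### The decomposition of one into conjugates of Young symmetrizers -/

section Decomposition

variable {n : ℕ}

theorem trace_mulRight (x : GroupAlg ℚ n) :
    LinearMap.trace ℚ _ (LinearMap.mulRight ℚ x) = n.factorial * x.coeff 1 := by
  rw [LinearMap.trace_eq_matrix_trace ℚ (MonoidAlgebra.basis (Perm (Fin n)) ℚ), Matrix.trace]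
  have (w : Perm (Fin n)) : LinearMap.toMatrix (MonoidAlgebra.basis (Perm (Fin n)) ℚ)
      (MonoidAlgebra.basis (Perm (Fin n)) ℚ) (LinearMap.mulRight ℚ x) w w = x.coeff 1 := by
    rw [LinearMap.toMatrix_apply, MonoidAlgebra.basis_apply]
    exact (coeff_perm_mul ℚ w w x).trans (by rw [inv_mul_cancel])
  simp [this, Fintype.card_perm]

/-- Right multiplication by `a_μ b_μ` has trace `n!` and is `κ` times a projection, so `n! / κ` is
the rank of that projection, which is the dimension of the Specht module. -/
theorem exists_mul_hookProduct_eq_factorial (μ : n.Partition) :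
    ∃ f : ℕ, (f : ℚ) * hookProduct ℚ μ = n.factorial := by
  have htr := trace_mulRight (youngSymmetrizer ℚ μ)
  rw [coeff_one_youngSymmetrizer, mul_one] at htr
  have hsq : LinearMap.mulRight ℚ (youngSymmetrizer ℚ μ) ∘ₗ
      LinearMap.mulRight ℚ (youngSymmetrizer ℚ μ) =
      hookProduct ℚ μ • LinearMap.mulRight ℚ (youngSymmetrizer ℚ μ) := by
    refine LinearMap.ext fun x => ?_
    simp [mul_assoc, youngSymmetrizer_mul_self ℚ (by simp) μ]
  have h0 : hookProduct ℚ μ ≠ 0 := by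
    intro h0
    rw [h0, zero_smul] at hsq
    have := LinearMap.isNilpotent_trace_of_isNilpotent
      (f := LinearMap.mulRight ℚ (youngSymmetrizer ℚ μ)) ⟨2, (sq _).trans hsq⟩
    rw [htr, isNilpotent_iff_eq_zero] at this
    exact n.factorial_ne_zero (by exact_mod_cast this)
  have hid : IsIdempotentElem
      ((hookProduct ℚ μ)⁻¹ • LinearMap.mulRight ℚ (youngSymmetrizer ℚ μ)) := by
    rw [IsIdempotentElem, smul_mul_smul_comm, Module.End.mul_eq_comp, hsq, smul_smul]
    congr 1
    field_simp
  have h := (LinearMap.IsIdempotentElem.isProj_range _ hid).trace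
  rw [map_smul, htr, smul_eq_mul] at h
  exact ⟨_, by rw [← h]; field_simp⟩

theorem hookProduct_ne_zero (μ : n.Partition) : hookProduct ℚ μ ≠ 0 := by
  obtain ⟨f, hf⟩ := exists_mul_hookProduct_eq_factorial μ
  intro h
  rw [h, mul_zero] at hf
  exact n.factorial_ne_zero (by exact_mod_cast hf.symm)

/-- The class function on `S_n` with prescribed values on the cycle types. -/
def classFunction (n : ℕ) :
    ((Fintype.card (Fin n)).Partition → ℚ) →ₗ[ℚ] GroupAlg ℚ n :=
  Fintype.linearCombination ℚ (fun w : Perm (Fin n) => perm ℚ w) ∘ₗ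
    LinearMap.funLeft ℚ ℚ Perm.partition

theorem exists_classFunction_eq {x : GroupAlg ℚ n} (hx : ∀ y, y * x = x * y) :
    ∃ φ, classFunction n φ = x := by
  have hconj (v w : Perm (Fin n)) (h : v.partition = w.partition) : x.coeff v = x.coeff w := by
    obtain ⟨u, rfl⟩ := isConj_iff.1 (Perm.partition_eq_of_isConj.2 h)
    have := congrArg (fun z => MonoidAlgebra.coeff z (u * v)) (hx (perm ℚ u))
    simpa [coeff_perm_mul, coeff_mul_perm] using this
  refine ⟨Function.extend Perm.partition (fun w => x.coeff w) 0, ?_⟩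
  conv_rhs => rw [eq_sum_coeff_smul_perm ℚ x]
  simp only [classFunction, LinearMap.comp_apply, Fintype.linearCombination_apply,
    LinearMap.funLeft_apply]
  refine Finset.sum_congr rfl fun w _ => ?_
  rw [Function.FactorsThrough.extend_apply fun v w h => hconj v w h]

theorem conjSum_ne_zero (μ : n.Partition) : conjSum ℚ μ ≠ 0 := by
  intro h
  have := coeff_one_conjSum ℚ μ
  rw [h] at this
  exact n.factorial_ne_zero (by simpa using this.symm)

theorem conjSum_mul_sum (r : n.Partition → ℚ) (μ : n.Partition) :
    conjSum ℚ μ * ∑ ν, r ν • conjSum ℚ ν = (r μ * hookProduct ℚ μ ^ 2) • conjSum ℚ μ := by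
  rw [Finset.mul_sum, Finset.sum_eq_single μ]
  · rw [mul_smul_comm, conjSum_mul_self ℚ (by simp), smul_smul]
  · intro ν _ hν
    rw [mul_smul_comm, conjSum_mul_conjSum_eq_zero ℚ (by simp) hν.symm, smul_zero]
  · simp

/-- The elements `conjSum ℚ μ` are as many as the conjugacy classes, and pairwise orthogonal, so
they span the center; expanding `1` and multiplying by one of them determines its coefficient. -/
theorem one_eq_sum_conjSum :
    (1 : GroupAlg ℚ n) = ∑ μ, (hookProduct ℚ μ ^ 2)⁻¹ • conjSum ℚ μ := by
  choose φ hφ using fun μ : n.Partition => exists_classFunction_eq (mul_conjSum_comm ℚ μ)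
  obtain ⟨ψ, hψ⟩ := exists_classFunction_eq (x := (1 : GroupAlg ℚ n)) (by simp)
  have hli : LinearIndependent ℚ φ := by
    refine LinearIndependent.of_comp (classFunction n) ?_
    rw [Fintype.linearIndependent_iff]
    intro r hr μ
    simp only [Function.comp_apply, hφ] at hr
    have := conjSum_mul_sum r μ
    rw [hr, mul_zero, eq_comm, smul_eq_zero] at this
    simpa [conjSum_ne_zero, hookProduct_ne_zero] using this
  have hspan := hli.span_eq_top_of_card_eq_finrank' (by simp)
  obtain ⟨r, hr⟩ := (Submodule.mem_span_range_iff_exists_fun ℚ).1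
    (hspan ▸ Submodule.mem_top : ψ ∈ Submodule.span ℚ (Set.range φ))
  have h1 : (1 : GroupAlg ℚ n) = ∑ μ, r μ • conjSum ℚ μ := by
    rw [← hψ, ← hr, map_sum]
    simp [hφ]
  refine h1.trans (Finset.sum_congr rfl fun μ _ => ?_)
  have h2 := conjSum_mul_sum r μ
  rw [← h1, mul_one] at h2
  have h3 : r μ * hookProduct ℚ μ ^ 2 = 1 :=
    (smul_left_injective ℚ (conjSum_ne_zero μ) (by simpa using h2.symm))
  rw [eq_inv_of_mul_eq_one_left h3]

theorem mapRingHom_perm {R S : Type*} [CommRing R] [CommRing S] (φ : R →+* S)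
    (w : Perm (Fin n)) : MonoidAlgebra.mapRingHom (Perm (Fin n)) φ (perm R w) = perm S w := by
  simp [perm]

theorem mapRingHom_smul {R S : Type*} [CommRing R] [CommRing S] (φ : R →+* S) (r : R)
    (x : GroupAlg R n) : MonoidAlgebra.mapRingHom (Perm (Fin n)) φ (r • x) =
      φ r • MonoidAlgebra.mapRingHom (Perm (Fin n)) φ x := by
  ext w
  simp

theorem mapRingHom_conjSum {R S : Type*} [CommRing R] [CommRing S] (φ : R →+* S)
    (μ : n.Partition) :
    MonoidAlgebra.mapRingHom (Perm (Fin n)) φ (conjSum R μ) = conjSum S μ := by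
  simp only [conjSum, youngSymmetrizer, rowSymmetrizer, colAntisymmetrizer, map_sum, map_mul,
    mapRingHom_perm, mapRingHom_smul, sgn, map_intCast]

/-- Over any base ring, `n!²` is a combination of the conjugates of the Young symmetrizers with
natural coefficients. The identity holds over `ℚ`, hence over `ℤ`, hence over `R`. -/
theorem exists_factorial_sq_smul_one_eq (R : Type*) [CommRing R] (n : ℕ) :
    ∃ f : n.Partition → ℕ,
      ((n.factorial : R) ^ 2) • (1 : GroupAlg R n) = ∑ μ, (f μ : R) ^ 2 • conjSum R μ := by
  choose f hf using exists_mul_hookProduct_eq_factorial (n := n)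
  refine ⟨f, ?_⟩
  have hQ : ((n.factorial : ℚ) ^ 2) • (1 : GroupAlg ℚ n) =
      ∑ μ, (f μ : ℚ) ^ 2 • conjSum ℚ μ := by
    rw [one_eq_sum_conjSum, Finset.smul_sum]
    refine Finset.sum_congr rfl fun μ _ => ?_
    rw [smul_smul, ← hf μ]
    congr 1
    have := hookProduct_ne_zero μ
    field_simp
  have hZ : ((n.factorial : ℤ) ^ 2) • (1 : GroupAlg ℤ n) =
      ∑ μ, (f μ : ℤ) ^ 2 • conjSum ℤ μ := by
    refine MonoidAlgebra.map_injective (Int.castRingHom ℚ : ℤ →+ ℚ)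
      (RingHom.injective_int (Int.castRingHom ℚ)) ?_
    change MonoidAlgebra.mapRingHom _ (Int.castRingHom ℚ) _ =
      MonoidAlgebra.mapRingHom _ (Int.castRingHom ℚ) _
    simpa only [mapRingHom_smul, map_sum, mapRingHom_conjSum, map_one, map_pow, map_natCast]
      using hQ
  have := congrArg (MonoidAlgebra.mapRingHom (Perm (Fin n)) (Int.castRingHom R)) hZ
  simpa only [mapRingHom_smul, map_sum, mapRingHom_conjSum, map_one, map_pow, map_natCast]
    using this

end Decomposition

/-! ### The ideal generated by the symmetrizers of `l`-element sets -/

section SymmetrizerIdeal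

variable (R : Type*) [CommRing R] {n : ℕ}

/-- The symmetrizer `∇_U`: the sum of all permutations that fix every element outside `U`. -/
def symmetrizer (U : Finset (Fin n)) : GroupAlg R n :=
  ∑ w : Perm (Fin n) with ∀ i, i ∉ U → w i = i, perm R w

/-- The two-sided ideal generated by the symmetrizers of the sets of size `l`. -/
def symmetrizerIdeal (n l : ℕ) : Submodule R (GroupAlg R n) :=
  ⊤ * Submodule.span R {x | ∃ U : Finset (Fin n), U.card = l ∧ x = symmetrizer R U} * ⊤

theorem signTwist_perm (w : Perm (Fin n)) : signTwist R n (perm R w) = sgn R w • perm R w := by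
  simp [signTwist, perm]

theorem signTwist_sgn_smul_perm (w : Perm (Fin n)) :
    signTwist R n (sgn R w • perm R w) = perm R w := by
  rw [map_smul, signTwist_perm, smul_smul, sgn_mul_self, one_smul]

theorem signTwist_antisymmetrizer (U : Finset (Fin n)) :
    signTwist R n (antisymmetrizer R U) = symmetrizer R U := by
  simp only [antisymmetrizer, map_sum, signTwist_sgn_smul_perm, symmetrizer]

theorem map_signTwist_top :
    (⊤ : Submodule R (GroupAlg R n)).map (signTwist R n).toLinearMap = ⊤ := by
  rw [Submodule.map_top, LinearMap.range_eq_top]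
  intro x
  refine ⟨∑ w, x.coeff w • sgn R w • perm R w, ?_⟩
  simp only [AlgHom.toLinearMap_apply, map_sum, map_smul (signTwist R n) (MonoidAlgebra.coeff x _),
    signTwist_sgn_smul_perm]
  exact (eq_sum_coeff_smul_perm R x).symm

theorem map_signTwist_idealJNat (l : ℕ) :
    (idealJNat R n l).map (signTwist R n).toLinearMap = symmetrizerIdeal R n (l + 1) := by
  rw [idealJNat, symmetrizerIdeal, Submodule.map_mul, Submodule.map_mul, map_signTwist_top,
    Submodule.map_span]
  congr 3
  ext x
  constructor
  · rintro ⟨_, ⟨U, hU, rfl⟩, rfl⟩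
    exact ⟨U, hU, signTwist_antisymmetrizer R U⟩
  · rintro ⟨U, hU, rfl⟩
    exact ⟨_, ⟨U, hU, rfl⟩, signTwist_antisymmetrizer R U⟩

theorem span_range_perm : Submodule.span R (Set.range (perm R (n := n))) = ⊤ := by
  refine eq_top_iff.2 fun x _ => ?_
  rw [eq_sum_coeff_smul_perm R x]
  exact Submodule.sum_mem _ fun w _ => Submodule.smul_mem _ _ (Submodule.subset_span ⟨w, rfl⟩)

theorem mul_mem_symmetrizerIdeal {l : ℕ} {x : GroupAlg R n} (y z : GroupAlg R n)
    (hx : x ∈ symmetrizerIdeal R n l) : y * x * z ∈ symmetrizerIdeal R n l := by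
  have : y * x * z ∈ ⊤ * symmetrizerIdeal R n l * ⊤ :=
    Submodule.mul_mem_mul (Submodule.mul_mem_mul Submodule.mem_top hx) Submodule.mem_top
  have htop : (⊤ : Submodule R (GroupAlg R n)) * ⊤ = ⊤ :=
    eq_top_iff.2 fun x _ => by
      simpa using Submodule.mul_mem_mul (Submodule.mem_top (x := x)) (Submodule.mem_top (x := 1))
  rwa [symmetrizerIdeal, ← mul_assoc, ← mul_assoc, mul_assoc _ ⊤ ⊤, htop] at this

/-- The permutation `u w v`, with `w` fixing the complement of `U` pointwise, is characterized by
its values on the preimage of this complement under `v`. -/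
theorem symmetrizerIdeal_le_span_tupleSum {k l : ℕ} (hkl : l + k = n) :
    symmetrizerIdeal R n l ≤
      Submodule.span R {x | ∃ a b : Fin k → Fin n, x = tupleSum R b a} := by
  rw [symmetrizerIdeal, ← span_range_perm, Submodule.span_mul_span, Submodule.span_mul_span]
  refine Submodule.span_mono ?_
  rintro _ ⟨_, ⟨_, ⟨u, rfl⟩, _, ⟨U, hU, rfl⟩, rfl⟩, _, ⟨v, rfl⟩, rfl⟩
  have hc : Uᶜ.card = k := by
    rw [Finset.card_compl, Fintype.card_fin, hU]
    lia
  have he (i : Fin n) : i ∉ U ↔ ∃ j, Uᶜ.orderEmbOfFin hc j = i := by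
    have := Set.ext_iff.1 (Uᶜ.range_orderEmbOfFin hc) i
    exact ⟨fun h => this.2 (by simpa using h), fun h => by simpa using this.1 h⟩
  refine ⟨fun j => v⁻¹ (Uᶜ.orderEmbOfFin hc j), fun j => u (Uᶜ.orderEmbOfFin hc j), ?_⟩
  simp only [symmetrizer, tupleSum, Finset.mul_sum, Finset.sum_mul, perm_mul_perm]
  refine Finset.sum_equiv ((Equiv.mulLeft u).trans (Equiv.mulRight v)) (fun w => ?_) (by simp)
  simp [he]

theorem mem_preimageAW {U : Set n.Partition} {x : GroupAlg R n} :
    x ∈ preimageAW R U ↔ ∀ μ ∉ U, ∀ z, x * z * youngSymmetrizer R μ = 0 := by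
  simp only [preimageAW, subproduct, Submodule.mem_comap, Submodule.mem_pi, Set.mem_compl_iff,
    Submodule.mem_bot]
  refine forall₂_congr fun μ _ => ⟨fun h z => ?_, fun h => LinearMap.ext fun y => ?_⟩
  · have := LinearMap.congr_fun h ⟨z * youngSymmetrizer R μ,
      Submodule.mem_span_singleton.2 ⟨z, rfl⟩⟩
    rw [mul_assoc]
    exact congrArg Subtype.val this
  · obtain ⟨y, hy⟩ := y
    obtain ⟨z, rfl⟩ := Submodule.mem_span_singleton.1 hy
    refine Subtype.ext ?_
    have := h z
    rw [mul_assoc] at this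
    exact this

theorem isUnit_two_of_ne (hn : IsUnit ((n.factorial : ℕ) : R)) {i j : Fin n} (hij : i ≠ j) :
    IsUnit (2 : R) := by
  have h2 : 2 ∣ n.factorial := Nat.dvd_factorial (by simp) (by
    have := i.isLt
    have := j.isLt
    have := Fin.val_ne_of_ne hij
    lia)
  have := isUnit_of_dvd_unit (Nat.cast_dvd_cast (α := R) h2) hn
  simpa using this

/-- At least `n - k` entries `i` do not occur in `a`. If the diagram of `μ` has fewer columns than
that, then two of these entries share a column, and `∇_{b,a}` is invariant under their transposition. -/
theorem span_tupleSum_le_preimageAW (hn : IsUnit ((n.factorial : ℕ) : R)) (k : ℕ) :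
    Submodule.span R {x : GroupAlg R n | ∃ a b : Fin k → Fin n, x = tupleSum R b a} ≤
      preimageAW R {μ : n.Partition | (n : ℤ) - (k : ℤ) ≤ (firstEntry μ : ℤ)} := by
  rw [Submodule.span_le]
  rintro _ ⟨a, b, rfl⟩
  refine (mem_preimageAW R).2 fun μ hμ z => ?_
  have hw (w : Perm (Fin n)) : tupleSum R b a * perm R w * colAntisymmetrizer R μ = 0 := by
    have hcard : (Finset.range (firstEntry μ)).card < (Finset.univ.image a)ᶜ.card := by
      have := (Finset.card_image_le (s := Finset.univ) (f := a))
      simp only [Finset.card_fin, Set.mem_ofPred_eq, not_le] at this hμ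
      rw [Finset.card_compl, Fintype.card_fin, Finset.card_range]
      lia
    obtain ⟨i, hi, j, hj, hij, hc⟩ := Finset.exists_ne_map_eq_of_card_lt_of_maps_to hcard
      (f := fun m => (rowTableau μ (w⁻¹ m)).2) fun m _ => by
        simpa using rowTableau_snd_lt μ _
    refine mul_perm_mul_colAntisymmetrizer_eq_zero R (isUnit_two_of_ne R hn hij) μ hij hc ?_
    refine sum_perm_mul_perm R fun v => forall_congr' fun t => ?_
    simp only [Finset.mem_compl, Finset.mem_image, Finset.mem_univ, true_and, not_exists] at hi hj
    rw [Perm.mul_apply, swap_apply_of_ne_of_ne (hi t) (hj t)]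
  have hx (x : GroupAlg R n) : tupleSum R b a * x * colAntisymmetrizer R μ = 0 := by
    rw [eq_sum_coeff_smul_perm R x, Finset.mul_sum, Finset.sum_mul]
    refine Finset.sum_eq_zero fun w _ => ?_
    rw [mul_smul_comm, smul_mul_assoc, hw, smul_zero]
  have := hx (z * rowSymmetrizer R μ)
  simpa only [youngSymmetrizer, mul_assoc] using this

/-- The number of permutations which fix the complement of `U` divides `n!`, so averaging over
this subgroup is possible. -/
theorem isUnit_card_fixing (hn : IsUnit ((n.factorial : ℕ) : R)) (U : Finset (Fin n)) :
    IsUnit ((Finset.card {w : Perm (Fin n) | ∀ i, i ∉ U → w i = i} : ℕ) : R) := by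
  have h := Subgroup.card_subgroup_dvd_card (fixingSubgroup (Perm (Fin n)) {i | i ∉ U})
  have hc : Nat.card (fixingSubgroup (Perm (Fin n)) {i | i ∉ U}) =
      Finset.card {w : Perm (Fin n) | ∀ i, i ∉ U → w i = i} := by
    rw [← Fintype.card_subtype, ← Nat.card_eq_fintype_card]
    exact Nat.card_congr (Equiv.subtypeEquivRight fun w => by simp [mem_fixingSubgroup_iff])
  rw [hc, Nat.card_perm, Nat.card_fin] at h
  exact isUnit_of_dvd_unit (Nat.cast_dvd_cast h) hn

theorem rowSymmetrizer_mem_symmetrizerIdeal (hn : IsUnit ((n.factorial : ℕ) : R)) {l : ℕ}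
    {μ : n.Partition} (hl : l ≤ firstEntry μ) : rowSymmetrizer R μ ∈ symmetrizerIdeal R n l := by
  rw [firstEntry_eq_rowLen, ← card_row] at hl
  obtain ⟨U, hU, hUl⟩ := Finset.exists_subset_card_eq hl
  have hrow (i) (hi : i ∈ U) : (rowTableau μ i).1 = 0 := (Finset.mem_filter.1 (hU hi)).2
  have hmul : rowSymmetrizer R μ * symmetrizer R U =
      ((Finset.card {w : Perm (Fin n) | ∀ i, i ∉ U → w i = i} : ℕ) : R) •
        rowSymmetrizer R μ := by
    rw [symmetrizer, Finset.mul_sum, Finset.sum_congr rfl fun w hw =>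
      rowSymmetrizer_mul_perm R μ fun m => ?_]
    · rw [Finset.sum_const, Nat.cast_smul_eq_nsmul]
    · have hw := (Finset.mem_filter.1 hw).2
      by_cases hm : m ∈ U
      · have hwm : w m ∈ U := by
          by_contra h
          rw [w.injective (hw _ h)] at h
          exact h hm
        rw [hrow _ hm, hrow _ hwm]
      · rw [hw m hm]
  rw [← Submodule.smul_mem_iff_of_isUnit _ (isUnit_card_fixing R hn U), ← hmul, ← mul_one (_ * _)]
  exact Submodule.mul_mem_mul (Submodule.mul_mem_mul Submodule.mem_top
    (Submodule.subset_span ⟨U, hUl, rfl⟩)) Submodule.mem_top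

/-- Multiply `x` by the decomposition of `n!²`: the terms of the partitions with a short first row
are annihilated by `x`, the other ones lie in the ideal. -/
theorem preimageAW_le_symmetrizerIdeal (hn : IsUnit ((n.factorial : ℕ) : R)) (l : ℕ) :
    preimageAW R {μ : n.Partition | l ≤ firstEntry μ} ≤ symmetrizerIdeal R n l := by
  intro x hx
  obtain ⟨f, hf⟩ := exists_factorial_sq_smul_one_eq R n
  rw [← Submodule.smul_mem_iff_of_isUnit _ (hn.pow 2), ← mul_one x, ← mul_smul_comm, hf,
    Finset.mul_sum]
  refine Submodule.sum_mem _ fun μ _ => ?_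
  rw [mul_smul_comm, conjSum, Finset.mul_sum]
  refine Submodule.smul_mem _ _ (Submodule.sum_mem _ fun w _ => ?_)
  by_cases hμ : l ≤ firstEntry μ
  · rw [youngSymmetrizer, ← mul_assoc (perm R w), mul_assoc _ _ (perm R w⁻¹), ← mul_assoc x,
      ← mul_assoc x]
    exact mul_mem_symmetrizerIdeal R _ _ (rowSymmetrizer_mem_symmetrizerIdeal R hn hμ)
  · rw [← mul_assoc, ← mul_assoc, (mem_preimageAW R).1 hx μ hμ, zero_mul]
    exact Submodule.zero_mem _

/-- For `k ≥ n` the tuple `a` may run through all of `1, …, n`, so that only one permutation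
remains in `∇_{b,a}`. -/
theorem span_tupleSum_eq_top {k : ℕ} (hk : n ≤ k) (h : 1 ≤ n ∨ k = 0) :
    Submodule.span R {x : GroupAlg R n | ∃ a b : Fin k → Fin n, x = tupleSum R b a} = ⊤ := by
  obtain ⟨a, ha⟩ : ∃ a : Fin k → Fin n, Function.Surjective a := by
    rcases Nat.eq_zero_or_pos n with rfl | h0
    · obtain rfl : k = 0 := by lia
      exact ⟨id, Function.surjective_id⟩
    · exact ⟨fun i => if hi : i.1 < n then ⟨i, hi⟩ else ⟨0, h0⟩,
        fun i => ⟨⟨i, i.isLt.trans_le hk⟩, by simp⟩⟩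
  rw [eq_top_iff, ← span_range_perm]
  refine Submodule.span_mono ?_
  rintro _ ⟨w, rfl⟩
  refine ⟨a, w ∘ a, ?_⟩
  rw [tupleSum, Finset.sum_eq_single_of_mem w (by simp)]
  intro v hv hvw
  refine absurd (Equiv.ext fun i => ?_) hvw
  obtain ⟨j, rfl⟩ := ha i
  exact (Finset.mem_filter.1 hv).2 j

end SymmetrizerIdeal

end SymGroupAlg

end

theorem mainTheorem10 (R : Type*) [CommRing R] (n : ℕ) (hn : IsUnit ((n.factorial : ℕ) : R))
    (k : ℕ) :
    (SymGroupAlg.idealJ R n ((n : ℤ) - (k : ℤ) - 1)).map (SymGroupAlg.signTwist R n).toLinearMap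
        = SymGroupAlg.preimageAW R
            {μ : n.Partition | (n : ℤ) - (k : ℤ) ≤ (SymGroupAlg.firstEntry μ : ℤ)} ∧
      (1 ≤ n ∨ k = 0 →
        Submodule.span R
            {x : SymGroupAlg.GroupAlg R n |
              ∃ a b : Fin k → Fin n, x = SymGroupAlg.tupleSum R b a}
          = SymGroupAlg.preimageAW R
              {μ : n.Partition | (n : ℤ) - (k : ℤ) ≤ (SymGroupAlg.firstEntry μ : ℤ)}) := by
  rcases Nat.lt_or_ge k n with hk | hk
  · obtain ⟨l, rfl⟩ := Nat.exists_eq_add_of_lt hk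
    have hJ : (SymGroupAlg.idealJ R (k + l + 1) (((k + l + 1 : ℕ) : ℤ) - (k : ℤ) - 1)).map
        (SymGroupAlg.signTwist R (k + l + 1)).toLinearMap =
          SymGroupAlg.symmetrizerIdeal R (k + l + 1) (l + 1) := by
      have : ((k + l + 1 : ℕ) : ℤ) - (k : ℤ) - 1 = l := by lia
      rw [this, SymGroupAlg.idealJ, if_neg (by lia), Int.toNat_natCast,
        SymGroupAlg.map_signTwist_idealJNat]
    have hU : {μ : (k + l + 1).Partition |
          ((k + l + 1 : ℕ) : ℤ) - (k : ℤ) ≤ (SymGroupAlg.firstEntry μ : ℤ)} =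
        {μ | l + 1 ≤ SymGroupAlg.firstEntry μ} := by
      ext μ
      simp only [Set.mem_ofPred_eq]
      lia
    have h1 := SymGroupAlg.symmetrizerIdeal_le_span_tupleSum R
      (show l + 1 + k = k + l + 1 by lia)
    have h2 := SymGroupAlg.span_tupleSum_le_preimageAW R hn k
    have h3 := SymGroupAlg.preimageAW_le_symmetrizerIdeal R hn (l + 1)
    rw [← hU] at h3
    rw [hJ]
    exact ⟨le_antisymm (h1.trans h2) h3, fun _ => le_antisymm h2 (h3.trans h1)⟩
  · have htop : SymGroupAlg.preimageAW R
        {μ : n.Partition | (n : ℤ) - (k : ℤ) ≤ (SymGroupAlg.firstEntry μ : ℤ)} = ⊤ := by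
      refine eq_top_iff.2 fun x _ => (SymGroupAlg.mem_preimageAW R).2 fun μ hμ => absurd ?_ hμ
      simp only [Set.mem_ofPred_eq]
      lia
    rw [htop, SymGroupAlg.idealJ, if_pos (by lia), SymGroupAlg.map_signTwist_top]
    exact ⟨rfl, SymGroupAlg.span_tupleSum_eq_top R hk⟩
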